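/- All graphs are finite and simple. For a graph $G$ let $\deg(u)$ be the degree of $u$ and $S_u=\sum_{v\in N_G(u)}\deg(v)$, and put $$ABC(G)=\sum_{uv\in E(G)}\sqrt{\frac{\deg(u)+\deg(v)-2}{\deg(u)\deg(v)}},\qquad GA(G)=\sum_{uv\in E(G)}\frac{2\sqrt{\deg(u)\deg(v)}}{\deg(u)+\deg(v)},$$ $$ABC_4(G)=\sum_{uv\in E(G)}\sqrt{\frac{S_u+S_v-2}{S_uS_v}},\qquad GA_5(G)=\sum_{uv\in E(G)}\frac{2\sqrt{S_uS_v}}{S_u+S_v}.$$ The planar octahedron network $POH(n)$ is constructed as follows. Start from the honeycomb network of dimension $n$ (a central hexagon surrounded by $n-1$ layers of hexagons), whose vertices are called silicon vertices. Place an oxide vertex on each of its edges and attach one further oxide vertex at each silicon vertex of degree two, so that every silicon vertex has exactly three oxide neighbours; join these three to each other. The silicon vertex and its three oxide neighbours form a silicate cell, drawn with the silicon vertex in the middle, and the whole graph is the silicate network of dimension $n$. For each of the three triangular faces (the silicon vertex and two of its oxide neighbours) of each cell add a new centroid vertex, joined to the two oxide vertices of that face; join the three centroid vertices of each cell to each other;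 finally delete all silicon vertices. **Theorem.** Let $G\cong POH(n)$. Then, for every $n\in\mathbb{N}$, $$ABC(G)=\tfrac34 n\bigl(4\sqrt6-2\sqrt{14}+3(4\sqrt5+2\sqrt6+\sqrt{14})n\bigr),\qquad GA(G)=12(3+2\sqrt2)n^2,$$ and, for every $n\ge 2$, $$\begin{aligned}ABC_4(G)=\tfrac1{440}\bigl(&264\sqrt{29}+88\sqrt{930}+24\sqrt{2255}+5280(n-1)+60\sqrt{330}(n-1)+24\sqrt{3410}(n-1)\\&+165\sqrt{94}(n-1)^2+528\sqrt{35}\,n+132\sqrt{38}\,n+330\sqrt{46}(n-1)n\\&+60\sqrt{86}(2n-3)+220\sqrt{35}(2-5n+3n^2)\bigr),\end{aligned}$$ $$\begin{aligned}GA_5(G)={}&8\sqrt2+6\sqrt{15}+\tfrac87\sqrt{110}+\tfrac{48}{23}\sqrt{33}(n-1)+\tfrac32\sqrt{55}(n-1)+\tfrac{96}{17}\sqrt{66}(n-1)\\&-36n+\tfrac{48}{11}\sqrt{30}\,n+36n^2+8\sqrt2(2-5n+3n^2).\end{aligned}$$ -/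

import Mathlib

/-! ### Degree based topological indices of a finite simple graph -/

section Indices

variable {V : Type*} [Fintype V]

open Classical in
/-- The degree of a vertex, as a real number. -/
noncomputable def vdeg (G : SimpleGraph V) (u : V) : ℝ := (G.degree u : ℝ)

open Classical in
/-- `S_u`: the sum of the degrees of the neighbours of `u`. -/
noncomputable def nbrDegSum (G : SimpleGraph V) (u : V) : ℝ :=
  ∑ v ∈ G.neighborFinset u, vdeg G v

open Classical in
/-- The atom-bond connectivity index. -/
noncomputable def abcIndex (G : SimpleGraph V) : ℝ :=
  ∑ e ∈ G.edgeFinset, Sym2.lift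
    ⟨fun u v => Real.sqrt ((vdeg G u + vdeg G v - 2) / (vdeg G u * vdeg G v)),
      fun u v => by dsimp only; rw [add_comm (vdeg G u), mul_comm (vdeg G u)]⟩ e

open Classical in
/-- The geometric-arithmetic index. -/
noncomputable def gaIndex (G : SimpleGraph V) : ℝ :=
  ∑ e ∈ G.edgeFinset, Sym2.lift
    ⟨fun u v => 2 * Real.sqrt (vdeg G u * vdeg G v) / (vdeg G u + vdeg G v),
      fun u v => by dsimp only; rw [add_comm (vdeg G u), mul_comm (vdeg G u)]⟩ e

open Classical in
/-- The fourth version of the atom-bond connectivity index. -/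
noncomputable def abc4Index (G : SimpleGraph V) : ℝ :=
  ∑ e ∈ G.edgeFinset, Sym2.lift
    ⟨fun u v => Real.sqrt
        ((nbrDegSum G u + nbrDegSum G v - 2) / (nbrDegSum G u * nbrDegSum G v)),
      fun u v => by dsimp only; rw [add_comm (nbrDegSum G u), mul_comm (nbrDegSum G u)]⟩ e

open Classical in
/-- The fifth version of the geometric-arithmetic index. -/
noncomputable def ga5Index (G : SimpleGraph V) : ℝ :=
  ∑ e ∈ G.edgeFinset, Sym2.lift
    ⟨fun u v => 2 * Real.sqrt (nbrDegSum G u * nbrDegSum G v) /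
        (nbrDegSum G u + nbrDegSum G v),
      fun u v => by dsimp only; rw [add_comm (nbrDegSum G u), mul_comm (nbrDegSum G u)]⟩ e

end Indices

/-! ### The honeycomb network -/

/-- Vertices of the honeycomb network of dimension `n`, in the usual three-coordinate addressing:
integer triples with entries in `[-n+1, n]` whose sum is `1` or `2`.  The hexagon centred at a
triple `c` of sum `0` consists of the six points `c + ε`, `ε ∈ {0,1}³` not constant, and the
network is the union of the hexagons with centres `|c i| ≤ n - 1`: one central hexagon surrounded
by `n - 1` layers. -/
def HoneycombVertex (n : ℕ) : Type :=
  {p : Fin 3 → ℤ // (∀ i, -(n : ℤ) + 1 ≤ p i ∧ p i ≤ n) ∧ (∑ i, p i = 1 ∨ ∑ i, p i = 2)}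

/-- The honeycomb network of dimension `n`: two vertices are adjacent when they differ in exactly
one coordinate, and there by one. -/
def honeycomb (n : ℕ) : SimpleGraph (HoneycombVertex n) where
  Adj p q := ∃ i, |p.1 i - q.1 i| = 1 ∧ ∀ j, j ≠ i → p.1 j = q.1 j
  symm := ⟨fun p q ⟨i, h, h'⟩ => ⟨i, by rw [abs_sub_comm]; exact h, fun j hj => (h' j hj).symm⟩⟩
  loopless := ⟨fun p ⟨i, h, _⟩ => by simp at h⟩

/-! ### Silicate networks -/

section Silicate

variable {V : Type*} (H : SimpleGraph V)

/-- Oxide vertices over a honeycomb `H` of silicon vertices: one subdividing each edge of `H`, and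
one pendant at each vertex of degree two. -/
abbrev Oxide : Type _ := H.edgeSet ⊕ {v : V // (H.neighborSet v).ncard = 2}

variable {H}

/-- The oxide vertex `o` lies in the silicate cell of the silicon vertex `s`. -/
def InCell (s : V) : Oxide H → Prop
  | .inl e => s ∈ (e : Sym2 V)
  | .inr t => t.1 = s

variable (H)

/-- The silicate network over `H`: each silicon vertex (left summand) is joined to the oxide
vertices of its cell, and these are joined to each other. -/
def silicate : SimpleGraph (V ⊕ Oxide H) where
  Adj
    | .inl _, .inl _ => False
    | .inl s, .inr o => InCell s o
    | .inr o, .inl s => InCell s o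
    | .inr o, .inr o' => o ≠ o' ∧ ∃ s, InCell s o ∧ InCell s o'
  symm := ⟨by
    rintro (s | o) (s' | o') h
    · exact h
    · exact h
    · exact h
    · exact ⟨h.1.symm, h.2.imp fun _ hs => hs.symm⟩⟩
  loopless := ⟨by
    rintro (s | o) h
    · exact h
    · exact h.1 rfl⟩

/-- A triangular face of a silicate cell (drawn with its silicon vertex in the middle): the silicon
vertex together with two of the oxide vertices adjacent to it. -/
@[ext]
structure TriFace where
  /-- the silicon vertex of the face -/
  silicon : V
  /-- the two oxide vertices of the face -/
  oxides : Finset (Oxide H)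
  card_oxides : oxides.card = 2
  adj_silicon : ∀ o ∈ oxides, (silicate H).Adj (.inl silicon) (.inr o)

/-- The octahedron network over `H`.  Its vertices are the oxide vertices of the silicate network
and one centroid vertex for each triangular face (the silicon vertices are removed).  The silicate
edges between oxide vertices are kept, a centroid is joined to the oxide vertices of its face, and
the centroids of the same silicate cell are joined to each other. -/
def octahedronNetwork : SimpleGraph (Oxide H ⊕ TriFace H) where
  Adj
    | .inl o, .inl o' => (silicate H).Adj (.inr o) (.inr o')
    | .inl o, .inr f => o ∈ f.oxides
    | .inr f, .inl o => o ∈ f.oxides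
    | .inr f, .inr f' => f ≠ f' ∧ f.silicon = f'.silicon
  symm := ⟨by
    rintro (o | f) (o' | f') h
    · exact SimpleGraph.Adj.symm h
    · exact h
    · exact h
    · exact ⟨h.1.symm, h.2.symm⟩⟩
  loopless := ⟨by
    rintro (o | f) h
    · exact (silicate H).loopless.irrefl _ h
    · exact h.1 rfl⟩

end Silicate

/-- The planar octahedron network `POH(n)`. -/
abbrev POH (n : ℕ) : SimpleGraph (Oxide (honeycomb n) ⊕ TriFace (honeycomb n)) :=
  octahedronNetwork (honeycomb n)

/-! ### Finiteness of the networks -/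

instance HoneycombVertex.finite (n : ℕ) : Finite (HoneycombVertex n) := by
  have h : {p : Fin 3 → ℤ | ∀ i, p i ∈ Set.Icc (-(n : ℤ) + 1) n}.Finite :=
    Set.Finite.pi' fun _ => Set.finite_Icc _ _
  exact (h.subset (t := {p : Fin 3 → ℤ | (∀ i, -(n : ℤ) + 1 ≤ p i ∧ p i ≤ n) ∧
    (∑ i, p i = 1 ∨ ∑ i, p i = 2)}) fun p hp => hp.1).to_subtype

instance TriFace.finite {V : Type*} [Finite V] (H : SimpleGraph V) : Finite (TriFace H) :=
  Finite.of_injective (fun f : TriFace H => (f.silicon, f.oxides)) fun f g h => by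
    have h' := Prod.ext_iff.1 h
    exact TriFace.ext h'.1 h'.2

/-! ### Graphs decomposed into octahedral cells -/

/-! The edges of the network split into octahedra, one per silicon vertex. The corners of a cell are
its three oxide vertices and its three centroids, and a centroid is opposite to the one oxide vertex
that its face omits. A centroid lies in one cell; an oxide vertex lies in two cells if it subdivides
a honeycomb edge and in one if it is pendant. Every edge lies in exactly one cell, so each index is
a sum over cells of a function of six corner labels (`CellDecomposition.sum_edgeFinset`).

Degrees depend only on which honeycomb directions are missing at a silicon vertex, and neighbour
degree sums also on those missing at its neighbours. Reflecting the vertices of coordinate sum 2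
makes this uniform: with reduced coordinates `x + y + z = 1` in `[1 - n, n]`, direction `i` is
missing exactly when coordinate `i` is `n` (`HoneycombVertex.nbr_eq_none_iff`), and a neighbour
reached in another direction lacks `i` exactly when coordinate `i` is `1 - n`
(`HoneycombVertex.reduced_of_nbr`). For `n ≥ 2` at most one coordinate is maximal and at most one is
minimal, so up to symmetry there are four kinds of cell.

It remains to count lattice points of a hexagon: `3 n ^ 2` in all, `3 n` with a maximal coordinate,
`3 (n + 1)` with a minimal one, 6 with both. Both honeycomb classes contribute equally, hence a
factor 2. Evaluating the weights gives the formulas. -/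

open Classical in
lemma two_mul_sum_edgeFinset {W : Type*} [Fintype W] (G : SimpleGraph W)
    (F : Sym2 W → ℝ) :
    2 * ∑ e ∈ G.edgeFinset, F e = ∑ d : G.Dart, F d.edge := by
  rw [← Finset.sum_fiberwise_of_maps_to (s := Finset.univ) (t := G.edgeFinset)
    (g := fun d : G.Dart => d.edge) (fun d _ => by simp [d.edge_mem]), Finset.mul_sum]
  refine Finset.sum_congr rfl fun e he => ?_
  rw [Finset.sum_congr rfl (g := fun _ => F e) (by simp +contextual), Finset.sum_const,
    SimpleGraph.dart_edge_fiber_card G e (by simpa using he)]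
  simp

-- Puts the degree in the same form as `nbrDegSum`, so that one formula for neighbour sums serves
-- both.
open Classical in
lemma vdeg_eq_sum {W : Type*} [Fintype W] (G : SimpleGraph W) (u : W) :
    vdeg G u = ∑ _v ∈ G.neighborFinset u, (1 : ℝ) := by
  simp [vdeg]

/-- A decomposition of the edges of `G` into octahedra, indexed by `S`.  The corners of an
octahedron are the elements of `Bool × Fin 3`; corners with the same second entry are opposite, and
all other pairs are joined by an edge.  Corners of the form `(true, i)` belong to one cell only,
while a corner `(false, i)` of the cell `s` may also be the corner `(false, i)` of one further cell
`nbr s i`. -/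
structure CellDecomposition {W : Type*} (G : SimpleGraph W) (S : Type*) where
  /-- the corners of the cells -/
  corner : S → Bool × Fin 3 → W
  /-- the cell that shares the corner `(false, i)` with a given cell -/
  nbr : S → Fin 3 → Option S
  adj_iff : ∀ u v, G.Adj u v ↔ ∃ s x y, x.2 ≠ y.2 ∧ corner s x = u ∧ corner s y = v
  corner_eq_iff : ∀ s t x y, corner s x = corner t y ↔
    x = y ∧ (s = t ∨ (x.1 = false ∧ nbr s x.2 = some t))
  nbr_ne : ∀ s i, nbr s i ≠ some s
  nbr_inj : ∀ s i j t, nbr s i = some t → nbr s j = some t → i = j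

namespace CellDecomposition

variable {W S : Type*} {G : SimpleGraph W}

/-- Transport of a cell decomposition along a graph isomorphism. -/
def ofIso {W' : Type*} {G' : SimpleGraph W'} (D : CellDecomposition G S) (e : G' ≃g G) :
    CellDecomposition G' S where
  corner s x := e.symm (D.corner s x)
  nbr := D.nbr
  adj_iff u v := by
    rw [← e.map_adj_iff, D.adj_iff]
    simp only [RelIso.symm_apply_eq]
  corner_eq_iff s t x y := by
    rw [e.symm.injective.eq_iff, D.corner_eq_iff]
  nbr_ne := D.nbr_ne
  nbr_inj := D.nbr_inj

variable (D : CellDecomposition G S)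

/-- An ordered edge determines its cell: two distinct cells with two common corners of different
directions would be neighbours in both directions, against `nbr_inj`. -/
lemma corner_inj {s s' : S} {x x' y y' : Bool × Fin 3} (h : x.2 ≠ y.2)
    (hx : D.corner s x = D.corner s' x') (hy : D.corner s y = D.corner s' y') :
    s = s' ∧ x = x' ∧ y = y' := by
  rw [D.corner_eq_iff] at hx hy
  refine ⟨?_, hx.1, hy.1⟩
  rcases hx.2 with h1 | h1
  · exact h1
  rcases hy.2 with h2 | h2
  · exact h2
  exact absurd (D.nbr_inj _ _ _ _ h1.2 h2.2) h

lemma adj_corner {s : S} {x y : Bool × Fin 3} (h : x.2 ≠ y.2) :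
    G.Adj (D.corner s x) (D.corner s y) :=
  (D.adj_iff _ _).2 ⟨s, x, y, h, rfl, rfl⟩

/-- The sum of `f` over the four corners of the cell `s` joined inside `s` to a corner with second
entry `i`. -/
def linkSum (f : W → ℝ) (s : S) (i : Fin 3) : ℝ :=
  ∑ y : Bool × Fin 3, if i ≠ y.2 then f (D.corner s y) else 0

lemma linkSum_eq (f : W → ℝ) (s : S) (i : Fin 3) :
    D.linkSum f s i = f (D.corner s (false, i + 1)) + f (D.corner s (false, i + 2)) +
      f (D.corner s (true, i + 1)) + f (D.corner s (true, i + 2)) := by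
  simp only [linkSum, Fintype.sum_prod_type, Fintype.sum_bool, Fin.sum_univ_three]
  fin_cases i <;> simp <;> ring

/-- The degree of the corner `(false, i)` of the cell `s`. -/
def cornerDeg (s : S) (i : Fin 3) : ℝ := (D.nbr s i).elim 4 fun _ => 8

variable [Fintype W] [Fintype S]

-- By `corner_inj`, a neighbour of `u` arises from exactly one cell with corner `u` and one corner
-- of that cell not opposite to `u`.
open Classical in
lemma sum_neighborFinset (f : W → ℝ) (u : W) :
    ∑ v ∈ G.neighborFinset u, f v =
      ∑ p : S × (Bool × Fin 3) with D.corner p.1 p.2 = u, D.linkSum f p.1 p.2.2 := by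
  simp only [linkSum]
  simp_rw [← Finset.sum_filter]
  rw [Finset.sum_sigma']
  symm
  refine Finset.sum_bij (fun p _ => D.corner p.1.1 p.2) ?_ ?_ ?_ ?_
  · rintro ⟨⟨s, x⟩, y⟩ h
    simp only [Finset.mem_sigma, Finset.mem_filter, Finset.mem_univ, true_and] at h
    rw [SimpleGraph.mem_neighborFinset, ← h.1]
    exact D.adj_corner h.2
  · rintro ⟨⟨s, x⟩, y⟩ h ⟨⟨s', x'⟩, y'⟩ h' e
    simp only [Finset.mem_sigma, Finset.mem_filter, Finset.mem_univ, true_and] at h h'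
    obtain ⟨rfl, rfl, rfl⟩ := D.corner_inj h.2 (h.1.trans h'.1.symm) e
    rfl
  · intro v hv
    rw [SimpleGraph.mem_neighborFinset, D.adj_iff] at hv
    obtain ⟨s, x, y, h, hx, hy⟩ := hv
    exact ⟨⟨⟨s, x⟩, y⟩, by simp [h, hx], hy⟩
  · intro _ _
    rfl

open Classical in
lemma sum_neighborFinset_true (f : W → ℝ) (s : S) (i : Fin 3) :
    ∑ v ∈ G.neighborFinset (D.corner s (true, i)), f v = D.linkSum f s i := by
  rw [D.sum_neighborFinset]
  have : Finset.univ.filter (fun p : S × (Bool × Fin 3) =>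
      D.corner p.1 p.2 = D.corner s (true, i)) = {(s, (true, i))} := by
    ext ⟨t, x⟩
    simp only [D.corner_eq_iff, Finset.mem_filter, Finset.mem_univ, true_and,
      Finset.mem_singleton, Prod.mk.injEq]
    constructor
    · rintro ⟨rfl, h | h⟩
      · exact ⟨h, rfl⟩
      · simp at h
    · rintro ⟨rfl, rfl⟩
      simp
  rw [this, Finset.sum_singleton]

open Classical in
lemma sum_neighborFinset_false (f : W → ℝ) (s : S) (i : Fin 3) :
    ∑ v ∈ G.neighborFinset (D.corner s (false, i)), f v =
      D.linkSum f s i + ((D.nbr s i).elim 0 fun t => D.linkSum f t i) := by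
  rw [D.sum_neighborFinset]
  have hmem (p : S × (Bool × Fin 3)) : D.corner p.1 p.2 = D.corner s (false, i) ↔
      p = (s, (false, i)) ∨ ∃ t, D.nbr s i = some t ∧ p = (t, (false, i)) := by
    obtain ⟨t, x⟩ := p
    -- `corner_eq_iff` is stated asymmetrically; the flip makes the second cell appear as `nbr s i`
    -- for the fixed cell `s`.
    rw [eq_comm, D.corner_eq_iff]
    constructor
    · rintro ⟨rfl, rfl | h⟩
      · exact .inl rfl
      · exact .inr ⟨t, h.2, rfl⟩
    · rintro (h | ⟨t', h, h'⟩)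
      · cases h
        simp
      · cases h'
        simpa using Or.inr h
  cases h : D.nbr s i with
  | none =>
    have : Finset.univ.filter (fun p : S × (Bool × Fin 3) =>
        D.corner p.1 p.2 = D.corner s (false, i)) = {(s, (false, i))} := by
      ext p
      simp [hmem, h]
    rw [this, Finset.sum_singleton]
    simp
  | some t =>
    have : Finset.univ.filter (fun p : S × (Bool × Fin 3) =>
        D.corner p.1 p.2 = D.corner s (false, i)) = {(s, (false, i)), (t, (false, i))} := by
      ext p
      simp [hmem, h]
    rw [this, Finset.sum_pair]
    · simp
    · intro e
      exact D.nbr_ne s i (h.trans (congrArg some (congrArg Prod.fst e).symm))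

lemma vdeg_true (s : S) (i : Fin 3) : vdeg G (D.corner s (true, i)) = 4 := by
  rw [vdeg_eq_sum, D.sum_neighborFinset_true, linkSum_eq]
  norm_num

lemma vdeg_false (s : S) (i : Fin 3) : vdeg G (D.corner s (false, i)) = D.cornerDeg s i := by
  rw [vdeg_eq_sum, D.sum_neighborFinset_false, cornerDeg]
  cases D.nbr s i <;> simp only [Option.elim, linkSum_eq] <;> norm_num

lemma nbrDegSum_true (s : S) (i : Fin 3) : nbrDegSum G (D.corner s (true, i)) =
    8 + (D.cornerDeg s (i + 1) + D.cornerDeg s (i + 2)) := by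
  rw [nbrDegSum, D.sum_neighborFinset_true, linkSum_eq]
  simp only [vdeg_true, vdeg_false]
  ring

lemma nbrDegSum_false (s : S) (i : Fin 3) : nbrDegSum G (D.corner s (false, i)) =
    8 + (D.cornerDeg s (i + 1) + D.cornerDeg s (i + 2)) + ((D.nbr s i).elim 0 fun t =>
      8 + (D.cornerDeg t (i + 1) + D.cornerDeg t (i + 2))) := by
  rw [nbrDegSum, D.sum_neighborFinset_false, linkSum_eq]
  cases D.nbr s i <;> simp only [Option.elim, linkSum_eq, vdeg_true, vdeg_false] <;> ring

end CellDecomposition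

/-- The sum of a symmetric function `g` over the edges of an octahedron whose corners `(false, i)`
carry the values `a, b, c` and whose opposite corners `(true, i)` carry the values `a', b', c'`. -/
def octahedronSum (g : ℝ → ℝ → ℝ) (a b c a' b' c' : ℝ) : ℝ :=
  g a b + g b c + g a c + (g a' b' + g b' c' + g a' c') +
    (g a b' + g a c' + g b a' + g b c' + g c a' + g c b')

/-- Together with `octahedronSum_swap` this generates all permutations of the three directions,
which reduces each kind of cell to one representative. -/
lemma octahedronSum_rotate (g : ℝ → ℝ → ℝ) (hg : ∀ a b, g a b = g b a) (a b c a' b' c' : ℝ) :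
    octahedronSum g a b c a' b' c' = octahedronSum g b c a b' c' a' := by
  simp only [octahedronSum]
  rw [hg c a, hg b a, hg c' a', hg b' a']
  ring

lemma octahedronSum_swap (g : ℝ → ℝ → ℝ) (hg : ∀ a b, g a b = g b a) (a b c a' b' c' : ℝ) :
    octahedronSum g a b c a' b' c' = octahedronSum g a c b a' c' b' := by
  simp only [octahedronSum]
  rw [hg c b, hg c' b']
  ring

namespace CellDecomposition

variable {W S : Type*} {G : SimpleGraph W} (D : CellDecomposition G S) [Fintype W] [Fintype S]

open Classical in
lemma sum_dart (F : Sym2 W → ℝ) : ∑ d : G.Dart, F d.edge =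
    ∑ s : S, ∑ x : Bool × Fin 3, ∑ y : Bool × Fin 3,
      if x.2 ≠ y.2 then F s(D.corner s x, D.corner s y) else 0 := by
  simp_rw [← Finset.sum_filter]
  rw [Finset.sum_sigma', Finset.sum_sigma']
  symm
  refine Finset.sum_bij (fun p h => ⟨(D.corner p.1.1 p.1.2, D.corner p.1.1 p.2),
    D.adj_corner (by simpa using h)⟩) ?_ ?_ ?_ ?_
  · intro _ _
    exact Finset.mem_univ _
  · rintro ⟨⟨s, x⟩, y⟩ h ⟨⟨s', x'⟩, y'⟩ h' e
    simp only [SimpleGraph.Dart.mk.injEq, Prod.mk.injEq] at e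
    obtain ⟨rfl, rfl, rfl⟩ := D.corner_inj (by simpa using h : x.2 ≠ y.2) e.1 e.2
    rfl
  · rintro ⟨⟨u, v⟩, h⟩ -
    obtain ⟨s, x, y, hxy, rfl, rfl⟩ := (D.adj_iff u v).1 h
    exact ⟨⟨⟨s, x⟩, y⟩, by simpa using hxy, rfl⟩
  · intro _ _
    rfl

-- Both sides are doubled: each edge carries two darts, and the sum over ordered pairs of
-- non-opposite corners meets each of the twelve edges of an octahedron twice.
open Classical in
lemma sum_edgeFinset (g : ℝ → ℝ → ℝ) (hg : ∀ a b, g a b = g b a) (w : W → ℝ)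
    (h : ∀ u v, g (w u) (w v) = g (w v) (w u)) :
    ∑ e ∈ G.edgeFinset, Sym2.lift ⟨fun u v => g (w u) (w v), h⟩ e =
      ∑ s : S, octahedronSum g (w (D.corner s (false, 0))) (w (D.corner s (false, 1)))
        (w (D.corner s (false, 2))) (w (D.corner s (true, 0))) (w (D.corner s (true, 1)))
        (w (D.corner s (true, 2))) := by
  have key := (two_mul_sum_edgeFinset G
    (Sym2.lift ⟨fun u v => g (w u) (w v), h⟩)).trans (D.sum_dart _)
  refine mul_left_cancel₀ two_ne_zero (key.trans ?_)
  rw [Finset.mul_sum]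
  refine Finset.sum_congr rfl fun s _ => ?_
  simp only [Fintype.sum_prod_type, Fintype.sum_bool, Fin.sum_univ_three, Sym2.lift_mk,
    octahedronSum]
  generalize w (D.corner s (false, 0)) = a
  generalize w (D.corner s (false, 1)) = b
  generalize w (D.corner s (false, 2)) = c
  generalize w (D.corner s (true, 0)) = a'
  generalize w (D.corner s (true, 1)) = b'
  generalize w (D.corner s (true, 2)) = c'
  simp only [ne_eq, Fin.reduceEq, not_true_eq_false, not_false_eq_true, if_true, if_false]
  rw [hg b a, hg c a, hg c b, hg b' a', hg c' a', hg c' b', hg b' a, hg c' a, hg a' b, hg c' b,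
    hg a' c, hg b' c]
  ring

end CellDecomposition

/-! ### The cells of an octahedron network -/

/-- A proper edge colouring of `H` by `Fin 3`, given by the partial functions that follow the edge
of a given colour, such that every vertex lacks at most one colour. -/
structure ThreeEdgeColoring {V : Type*} (H : SimpleGraph V) where
  /-- the end of the edge of colour `i` at `s` -/
  nbr : V → Fin 3 → Option V
  adj_iff : ∀ s t, H.Adj s t ↔ ∃ i, nbr s i = some t
  symm : ∀ {s i t}, nbr s i = some t → nbr t i = some s
  inj : ∀ {s i j t}, nbr s i = some t → nbr s j = some t → i = j
  none_unique : ∀ {s i j}, nbr s i = none → nbr s j = none → i = j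

namespace ThreeEdgeColoring

variable {V : Type*} {H : SimpleGraph V} (C : ThreeEdgeColoring H)

lemma adj {s t : V} {i : Fin 3} (h : C.nbr s i = some t) : H.Adj s t :=
  (C.adj_iff s t).2 ⟨i, h⟩

/-- Distinct colours lead to distinct neighbours and at most one colour is missing, so the degree is
3 or 2. The pendant oxide vertex can thus be assigned to the missing colour. -/
lemma neighborSet_ncard_eq_two_iff (s : V) :
    (H.neighborSet s).ncard = 2 ↔ ∃ i, C.nbr s i = none := by
  have hset : H.neighborSet s = {t | ∃ i, C.nbr s i = some t} := by
    ext t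
    exact C.adj_iff s t
  constructor
  · intro h
    by_contra! hn
    have hn' (i : Fin 3) : ∃ t, C.nbr s i = some t := Option.ne_none_iff_exists'.1 (hn i)
    choose f hf using hn'
    have hinj : Function.Injective f := fun i j hij => C.inj (hf i) (hij ▸ hf j)
    have : H.neighborSet s = f '' Set.univ := by
      rw [hset]
      ext t
      simp [hf]
    rw [this, Set.ncard_image_of_injective _ hinj, Set.ncard_univ, Nat.card_fin] at h
    omega
  · rintro ⟨i, hi⟩
    have hn' (j : Fin 3) (hj : j ≠ i) : ∃ t, C.nbr s j = some t :=
      Option.ne_none_iff_exists'.1 fun h => hj (C.none_unique h hi)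
    obtain ⟨t, ht⟩ := hn' (i + 1) (by fin_cases i <;> decide)
    obtain ⟨t', ht'⟩ := hn' (i + 2) (by fin_cases i <;> decide)
    have hne : t ≠ t' := by
      rintro rfl
      have := C.inj ht ht'
      revert this
      fin_cases i <;> decide
    have : H.neighborSet s = {t, t'} := by
      rw [hset]
      ext u
      have hi3 (P : Fin 3 → Prop) : (∃ j, P j) ↔ P i ∨ P (i + 1) ∨ P (i + 2) := by
        rw [Fin.exists_fin_succ, Fin.exists_fin_two]
        fin_cases i <;> simp <;> tauto
      simp [hi3, hi, ht, ht', eq_comm]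
    rw [this, Set.ncard_pair hne]

/-- The oxide vertex of the cell of `s` in direction `i`. -/
def oxide (s : V) (i : Fin 3) : Oxide H :=
  match h : C.nbr s i with
  | some t => .inl ⟨s(s, t), C.adj h⟩
  | none => .inr ⟨s, (C.neighborSet_ncard_eq_two_iff s).2 ⟨i, h⟩⟩

lemma oxide_of_some {s t : V} {i : Fin 3} (h : C.nbr s i = some t) :
    C.oxide s i = .inl ⟨s(s, t), C.adj h⟩ := by
  unfold oxide
  split
  · next t' h' =>
    obtain rfl : t' = t := Option.some.inj (h'.symm.trans h)
    rfl
  · next h' => cases h.symm.trans h'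

lemma oxide_of_none {s : V} {i : Fin 3} (h : C.nbr s i = none) :
    C.oxide s i = .inr ⟨s, (C.neighborSet_ncard_eq_two_iff s).2 ⟨i, h⟩⟩ := by
  unfold oxide
  split
  · next h' => cases h.symm.trans h'
  · rfl

lemma inCell_iff (s : V) (o : Oxide H) : InCell s o ↔ ∃ i, C.oxide s i = o := by
  constructor
  · rcases o with ⟨e, he⟩ | ⟨t, ht⟩
    · intro h
      obtain ⟨t, rfl⟩ : ∃ t, e = s(s, t) := h
      obtain ⟨i, hi⟩ := (C.adj_iff s t).1 he
      exact ⟨i, C.oxide_of_some hi⟩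
    · rintro rfl
      obtain ⟨i, hi⟩ := (C.neighborSet_ncard_eq_two_iff t).1 ht
      exact ⟨i, C.oxide_of_none hi⟩
  · rintro ⟨i, rfl⟩
    cases h : C.nbr s i with
    | none =>
      rw [C.oxide_of_none h]
      rfl
    | some t =>
      rw [C.oxide_of_some h]
      exact Sym2.mem_mk_left s t

/-- Cells share an oxide vertex only across a honeycomb edge, and that edge has the same colour seen
from either end. -/
lemma oxide_eq_iff (s t : V) (i j : Fin 3) :
    C.oxide s i = C.oxide t j ↔ i = j ∧ (s = t ∨ C.nbr s i = some t) := by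
  constructor
  · intro h
    cases hs : C.nbr s i with
    | none =>
      cases ht : C.nbr t j with
      | none =>
        rw [C.oxide_of_none hs, C.oxide_of_none ht] at h
        obtain rfl : s = t := by simpa using h
        exact ⟨C.none_unique hs ht, .inl rfl⟩
      | some t' =>
        rw [C.oxide_of_none hs, C.oxide_of_some ht] at h
        cases h
    | some s' =>
      cases ht : C.nbr t j with
      | none =>
        rw [C.oxide_of_some hs, C.oxide_of_none ht] at h
        cases h
      | some t' =>
        rw [C.oxide_of_some hs, C.oxide_of_some ht] at h
        have h' : s(s, s') = s(t, t') := congrArg Subtype.val (Sum.inl.inj h)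
        rcases Sym2.eq_iff.1 h' with ⟨rfl, rfl⟩ | ⟨rfl, rfl⟩
        · exact ⟨C.inj hs ht, .inl rfl⟩
        · exact ⟨C.inj hs (C.symm ht), .inr rfl⟩
  · rintro ⟨rfl, rfl | h⟩
    · rfl
    · rw [C.oxide_of_some h, C.oxide_of_some (C.symm h)]
      simp [Sym2.eq_swap]

lemma oxide_injective (s : V) : Function.Injective (C.oxide s) :=
  fun _ _ h => ((C.oxide_eq_iff _ _ _ _).1 h).1

open Classical in
/-- The face of the cell of `s` opposite to the oxide vertex in direction `i`. -/
noncomputable def face (s : V) (i : Fin 3) : TriFace H where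
  silicon := s
  oxides := (Finset.univ.erase i).image (C.oxide s)
  card_oxides := by
    rw [Finset.card_image_of_injective _ (C.oxide_injective s)]
    simp
  adj_silicon o ho := by
    obtain ⟨j, -, rfl⟩ := Finset.mem_image.1 ho
    exact (C.inCell_iff _ _).2 ⟨j, rfl⟩

lemma mem_oxides_face {s : V} {i : Fin 3} {o : Oxide H} :
    o ∈ (C.face s i).oxides ↔ ∃ j, j ≠ i ∧ C.oxide s j = o := by
  simp [face]

lemma oxide_mem_face_iff {s : V} {i j : Fin 3} :
    C.oxide s j ∈ (C.face s i).oxides ↔ j ≠ i := by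
  simp [mem_oxides_face, (C.oxide_injective s).eq_iff]

/-- A face remembers its silicon vertex, so centroids, unlike oxide vertices, are never shared
between cells. -/
lemma face_eq_iff (s t : V) (i j : Fin 3) : C.face s i = C.face t j ↔ i = j ∧ s = t := by
  constructor
  · intro h
    obtain rfl : s = t := congrArg TriFace.silicon h
    refine ⟨?_, rfl⟩
    by_contra hij
    have := (C.oxide_mem_face_iff (s := s)).2 hij
    rw [← h] at this
    exact C.oxide_mem_face_iff.1 this rfl
  · rintro ⟨rfl, rfl⟩
    rfl

lemma exists_face_eq (f : TriFace H) : ∃ i, C.face f.silicon i = f := by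
  classical
  have hsub : f.oxides ⊆ Finset.univ.image (C.oxide f.silicon) := fun o ho => by
    obtain ⟨i, rfl⟩ := (C.inCell_iff _ _).1 (f.adj_silicon o ho)
    simp
  have hcard : (Finset.univ.image (C.oxide f.silicon)).card = 3 := by
    rw [Finset.card_image_of_injective _ (C.oxide_injective _)]
    simp
  obtain ⟨o, ho, ho'⟩ := Finset.exists_mem_notMem_of_card_lt_card
    (s := f.oxides) (t := Finset.univ.image (C.oxide f.silicon))
    (by rw [hcard, f.card_oxides]; norm_num)
  obtain ⟨i, -, rfl⟩ := Finset.mem_image.1 ho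
  -- Here `i` is the direction of an oxide vertex that `f` omits; both faces have two oxide
  -- vertices, so one inclusion suffices.
  refine ⟨i, TriFace.ext rfl (Finset.eq_of_subset_of_card_le (fun o h => ?_) ?_).symm⟩
  · obtain ⟨j, -, rfl⟩ := Finset.mem_image.1 (hsub h)
    refine C.oxide_mem_face_iff.2 ?_
    rintro rfl
    exact ho' h
  · rw [TriFace.card_oxides, TriFace.card_oxides]

/-- The corners of the cell of `s` in the octahedron network. -/
noncomputable def corner (s : V) : Bool × Fin 3 → Oxide H ⊕ TriFace H
  | (false, i) => .inl (C.oxide s i)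
  | (true, i) => .inr (C.face s i)

lemma adj_corner (s : V) (x y : Bool × Fin 3) (h : x.2 ≠ y.2) :
    (octahedronNetwork H).Adj (C.corner s x) (C.corner s y) := by
  obtain ⟨_ | _, i⟩ := x <;> obtain ⟨_ | _, j⟩ := y
  · exact ⟨fun e => h (C.oxide_injective s e), s, (C.inCell_iff _ _).2 ⟨i, rfl⟩,
      (C.inCell_iff _ _).2 ⟨j, rfl⟩⟩
  · exact C.oxide_mem_face_iff.2 h
  · exact C.oxide_mem_face_iff.2 h.symm
  · exact ⟨fun e => h ((C.face_eq_iff _ _ _ _).1 e).1, rfl⟩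

lemma exists_corner_of_adj {u v : Oxide H ⊕ TriFace H} (h : (octahedronNetwork H).Adj u v) :
    ∃ s x y, x.2 ≠ y.2 ∧ C.corner s x = u ∧ C.corner s y = v := by
  rcases u with o | f <;> rcases v with o' | f'
  · obtain ⟨hne, s, hs, hs'⟩ := h
    obtain ⟨i, rfl⟩ := (C.inCell_iff _ _).1 hs
    obtain ⟨j, rfl⟩ := (C.inCell_iff _ _).1 hs'
    exact ⟨s, (false, i), (false, j), fun e => hne (congrArg _ e), rfl, rfl⟩
  · obtain ⟨j, hj⟩ := C.exists_face_eq f'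
    have h : o ∈ f'.oxides := h
    rw [← hj] at h
    obtain ⟨i, hi, rfl⟩ := C.mem_oxides_face.1 h
    exact ⟨f'.silicon, (false, i), (true, j), hi, rfl, congrArg Sum.inr hj⟩
  · obtain ⟨j, hj⟩ := C.exists_face_eq f
    have h : o' ∈ f.oxides := h
    rw [← hj] at h
    obtain ⟨i, hi, rfl⟩ := C.mem_oxides_face.1 h
    exact ⟨f.silicon, (true, j), (false, i), hi.symm, congrArg Sum.inr hj, rfl⟩
  · obtain ⟨hne, hs⟩ := h
    obtain ⟨i, hi⟩ := C.exists_face_eq f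
    obtain ⟨j, hj⟩ := C.exists_face_eq f'
    rw [← hs] at hj
    refine ⟨f.silicon, (true, i), (true, j), ?_, congrArg Sum.inr hi, congrArg Sum.inr hj⟩
    rintro rfl
    exact hne (hi.symm.trans hj)

/-- The octahedron network over a graph with a colouring as above decomposes into octahedra, one for
each vertex of the graph. -/
noncomputable def cellDecomposition : CellDecomposition (octahedronNetwork H) V where
  corner := C.corner
  nbr := C.nbr
  adj_iff u v := by
    refine ⟨C.exists_corner_of_adj, ?_⟩
    rintro ⟨s, x, y, h, rfl, rfl⟩
    exact C.adj_corner s x y h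
  corner_eq_iff s t x y := by
    obtain ⟨_ | _, i⟩ := x <;> obtain ⟨_ | _, j⟩ := y <;>
      simp [corner, oxide_eq_iff, face_eq_iff]
  nbr_ne s i h := (C.adj h).ne rfl
  nbr_inj _ _ _ _ := C.inj

end ThreeEdgeColoring

/-! ### The honeycomb network -/

namespace HoneycombVertex

variable {n : ℕ}

@[ext]
lemma ext {s t : HoneycombVertex n} (h : ∀ i, s.1 i = t.1 i) : s = t :=
  Subtype.ext (funext h)

/-- Coordinates adapted to the class of a vertex: a vertex with coordinate sum `2` is reflected to
one with coordinate sum `1`. -/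
def reduced (s : HoneycombVertex n) (i : Fin 3) : ℤ :=
  if ∑ j, s.1 j = 1 then s.1 i else 1 - s.1 i

lemma reduced_mem (s : HoneycombVertex n) (i : Fin 3) :
    -(n : ℤ) + 1 ≤ s.reduced i ∧ s.reduced i ≤ n := by
  have := s.2.1 i
  unfold reduced
  split_ifs <;> omega

lemma sum_reduced (s : HoneycombVertex n) :
    s.reduced 0 + s.reduced 1 + s.reduced 2 = 1 := by
  have := s.2.2
  simp only [reduced, Fin.sum_univ_three] at this ⊢
  split_ifs <;> omega

/-- The point reached from `s` by changing the coordinate `i`. -/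
def step (s : HoneycombVertex n) (i : Fin 3) : Fin 3 → ℤ :=
  Function.update s.1 i (if ∑ j, s.1 j = 1 then s.1 i + 1 else s.1 i - 1)

/-- The interval `[1 - n, n]` is invariant under `x ↦ 1 - x`, so lowering a coordinate of a sum-2
vertex is raising a reduced coordinate; the only obstruction is the upper bound. -/
lemma step_mem_iff (s : HoneycombVertex n) (i : Fin 3) :
    ((∀ j, -(n : ℤ) + 1 ≤ s.step i j ∧ s.step i j ≤ n) ∧
      (∑ j, s.step i j = 1 ∨ ∑ j, s.step i j = 2)) ↔ s.reduced i ≠ n := by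
  have h0 := s.2.1 0
  have h1 := s.2.1 1
  have h2 := s.2.1 2
  have h := s.2.2
  simp only [Fin.sum_univ_three, Fin.forall_fin_succ, step, reduced] at *
  fin_cases i <;> simp [Function.update] at * <;> split_ifs <;> omega

/-- The sums of adjacent vertices differ by one and lie in `{1, 2}`, which fixes the sign of the
change. -/
lemma eq_step_iff (s t : HoneycombVertex n) (i : Fin 3) :
    t.1 = s.step i ↔ |s.1 i - t.1 i| = 1 ∧ ∀ j, j ≠ i → s.1 j = t.1 j := by
  have h := s.2.2
  have h' := t.2.2
  rw [funext_iff, abs_eq zero_le_one]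
  simp only [Fin.sum_univ_three, Fin.forall_fin_succ, step] at *
  fin_cases i <;> simp [Function.update] at * <;> split_ifs <;> omega

open Classical in
/-- The neighbour of `s` that differs from `s` in the coordinate `i`. -/
noncomputable def nbr (s : HoneycombVertex n) (i : Fin 3) : Option (HoneycombVertex n) :=
  if h : (∀ j, -(n : ℤ) + 1 ≤ s.step i j ∧ s.step i j ≤ n) ∧
      (∑ j, s.step i j = 1 ∨ ∑ j, s.step i j = 2) then some ⟨s.step i, h⟩ else none

lemma nbr_eq_none_iff (s : HoneycombVertex n) (i : Fin 3) :
    s.nbr i = none ↔ s.reduced i = n := by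
  rw [← not_iff_not, ← ne_eq (s.reduced i), ← step_mem_iff, nbr]
  split_ifs with h
  · exact iff_of_true (by simp) h
  · exact iff_of_false (by simp) h

lemma nbr_eq_some_iff (s t : HoneycombVertex n) (i : Fin 3) :
    s.nbr i = some t ↔ |s.1 i - t.1 i| = 1 ∧ ∀ j, j ≠ i → s.1 j = t.1 j := by
  rw [← eq_step_iff, nbr]
  constructor
  · intro h
    split_ifs at h with hs
    rw [← Option.some.inj h]
  · intro h
    rw [dif_pos (h ▸ t.2)]
    exact congrArg some (Subtype.ext h.symm)

/-- Adjacent vertices have different coordinate sums, so exactly one of the two is reflected, while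
coordinate `j` itself does not change. -/
lemma reduced_of_nbr {s t : HoneycombVertex n} {i : Fin 3} (h : s.nbr i = some t) {j : Fin 3}
    (hj : j ≠ i) : t.reduced j = 1 - s.reduced j := by
  rw [nbr_eq_some_iff, abs_eq zero_le_one] at h
  obtain ⟨h1, h2⟩ := h
  have h2j := h2 j hj
  have hs := s.2.2
  have ht := t.2.2
  have : ∑ k, s.1 k ≠ ∑ k, t.1 k := by
    rw [← Finset.add_sum_erase _ _ (Finset.mem_univ i), ← Finset.add_sum_erase _ t.1
      (Finset.mem_univ i), Finset.sum_congr rfl fun k hk => h2 k (Finset.ne_of_mem_erase hk)]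
    intro h
    rw [add_left_inj] at h
    omega
  unfold reduced
  split_ifs <;> omega

end HoneycombVertex

/-- The edges of the honeycomb network, coloured by direction. -/
noncomputable def honeycombColoring (n : ℕ) : ThreeEdgeColoring (honeycomb n) where
  nbr := HoneycombVertex.nbr
  adj_iff s t := by
    simp only [HoneycombVertex.nbr_eq_some_iff]
    rfl
  symm {s i t} h := by
    rw [HoneycombVertex.nbr_eq_some_iff] at h ⊢
    exact ⟨by rw [abs_sub_comm]; exact h.1, fun j hj => (h.2 j hj).symm⟩
  inj {s i j t} h h' := by
    rw [HoneycombVertex.nbr_eq_some_iff] at h h'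
    by_contra hij
    have := h'.2 i hij
    rw [this] at h
    simp at h
  -- Two reduced coordinates equal to `n` would make the third `1 - 2 * n`, below the bound `1 - n`;
  -- for `n = 0` there are no vertices.
  none_unique {s i j} h h' := by
    rw [HoneycombVertex.nbr_eq_none_iff] at h h'
    have h0 := s.reduced_mem 0
    have h1 := s.reduced_mem 1
    have h2 := s.reduced_mem 2
    have hs := s.sum_reduced
    fin_cases i <;> fin_cases j <;> simp at h h' ⊢ <;> omega

/-! ### Counting the vertices of the honeycomb network -/

/-- The points of the plane `x + y + z = 1` with coordinates in `[-n + 1, n]`, given by their first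
two coordinates. -/
noncomputable def hexPoints (n : ℕ) : Finset (ℤ × ℤ) :=
  {p ∈ Finset.Icc (-(n : ℤ) + 1) n ×ˢ Finset.Icc (-(n : ℤ) + 1) n |
    -(n : ℤ) + 1 ≤ 1 - p.1 - p.2 ∧ 1 - p.1 - p.2 ≤ n}

lemma mem_hexPoints {n : ℕ} {p : ℤ × ℤ} : p ∈ hexPoints n ↔
    (-(n : ℤ) + 1 ≤ p.1 ∧ p.1 ≤ n) ∧ (-(n : ℤ) + 1 ≤ p.2 ∧ p.2 ≤ n) ∧
      (-(n : ℤ) + 1 ≤ 1 - p.1 - p.2 ∧ 1 - p.1 - p.2 ≤ n) := by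
  simp only [hexPoints, Finset.mem_filter, Finset.mem_product, Finset.mem_Icc]
  tauto

/-- Reduced coordinates map each of the two classes bijectively onto the hexagon. -/
lemma HoneycombVertex.sum_eq_two_mul {n : ℕ} [Fintype (HoneycombVertex n)] (F : ℤ → ℤ → ℤ → ℝ) :
    ∑ s : HoneycombVertex n, F (s.reduced 0) (s.reduced 1) (s.reduced 2) =
      2 * ∑ p ∈ hexPoints n, F p.1 p.2 (1 - p.1 - p.2) := by
  classical
  have key (b : Bool) : ∑ s : HoneycombVertex n with decide (∑ j, s.1 j = 1) = b,
      F (s.reduced 0) (s.reduced 1) (s.reduced 2) =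
        ∑ p ∈ hexPoints n, F p.1 p.2 (1 - p.1 - p.2) := by
    refine Finset.sum_bij (fun s _ => (s.reduced 0, s.reduced 1)) ?_ ?_ ?_ ?_
    · intro s _
      rw [mem_hexPoints]
      have h0 := s.reduced_mem 0
      have h1 := s.reduced_mem 1
      have h2 := s.reduced_mem 2
      have hs := s.sum_reduced
      dsimp only
      omega
    · intro s hs t ht h
      simp only [Finset.mem_filter, Finset.mem_univ, true_and] at hs ht
      have h0 : s.reduced 0 = t.reduced 0 := congrArg Prod.fst h
      have h1 : s.reduced 1 = t.reduced 1 := congrArg Prod.snd h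
      have h2 : s.reduced 2 = t.reduced 2 := by
        have := s.sum_reduced
        have := t.sum_reduced
        omega
      have hiff : (∑ j, s.1 j = 1) ↔ (∑ j, t.1 j = 1) := by
        rw [← decide_eq_decide, hs, ht]
      have key (i : Fin 3) (h : s.reduced i = t.reduced i) : s.1 i = t.1 i := by
        simp only [reduced, hiff] at h
        split_ifs at h <;> omega
      ext i
      fin_cases i
      exacts [key 0 h0, key 1 h1, key 2 h2]
    · rintro ⟨x, y⟩ hp
      rw [mem_hexPoints] at hp
      dsimp only at hp
      cases b
      -- The sum-2 preimage is the reflection of `(x, y, z)`; its last entry is `1 - z = x + y`.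
      · refine ⟨⟨![1 - x, 1 - y, x + y], ?_, ?_⟩, ?_, ?_⟩
        · simp [Fin.forall_fin_succ]
          omega
        · right
          simp [Fin.sum_univ_three]
          ring
        · refine Finset.mem_filter.2 ⟨Finset.mem_univ _, ?_⟩
          simp [Fin.sum_univ_three]
          omega
        · simp [reduced, Fin.sum_univ_three]
          omega
      · refine ⟨⟨![x, y, 1 - x - y], ?_, ?_⟩, ?_, ?_⟩
        · simp [Fin.forall_fin_succ]
          omega
        · simp [Fin.sum_univ_three]
        · refine Finset.mem_filter.2 ⟨Finset.mem_univ _, ?_⟩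
          simp [Fin.sum_univ_three]
        · simp [reduced, Fin.sum_univ_three]
    · intro s _
      have : s.reduced 2 = 1 - s.reduced 0 - s.reduced 1 := by
        have := s.sum_reduced
        omega
      rw [this]
  rw [← Finset.sum_fiberwise Finset.univ (fun s : HoneycombVertex n => decide (∑ j, s.1 j = 1)),
    Fintype.sum_bool, key, key, two_mul]

/-! ### Extremal coordinates in the hexagon. -/

/-- The indicator of a point, as a real valued function. -/
noncomputable def ind (m t : ℤ) : ℝ := if t = m then 1 else 0

lemma ind_eq_one_iff {m t : ℤ} : ind m t = 1 ↔ t = m := by simp [ind]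

lemma ind_eq_zero_iff {m t : ℤ} : ind m t = 0 ↔ t ≠ m := by simp [ind]

lemma sum_hexPoints_rotate (n : ℕ) (F : ℤ → ℤ → ℤ → ℝ) :
    ∑ p ∈ hexPoints n, F p.2 (1 - p.1 - p.2) p.1 =
      ∑ p ∈ hexPoints n, F p.1 p.2 (1 - p.1 - p.2) := by
  refine Finset.sum_nbij' (fun p => (p.2, 1 - p.1 - p.2)) (fun p => (1 - p.1 - p.2, p.1))
    ?_ ?_ ?_ ?_ ?_
  · intro p hp
    rw [mem_hexPoints] at hp ⊢
    dsimp only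
    omega
  · intro p hp
    rw [mem_hexPoints] at hp ⊢
    dsimp only
    omega
  · intro p _
    ext <;> dsimp only
    ring
  · intro p _
    ext <;> dsimp only
    ring
  · intro p _
    dsimp only
    congr 1
    ring

lemma sum_hexPoints_swap (n : ℕ) (F : ℤ → ℤ → ℤ → ℝ) :
    ∑ p ∈ hexPoints n, F p.2 p.1 (1 - p.1 - p.2) =
      ∑ p ∈ hexPoints n, F p.1 p.2 (1 - p.1 - p.2) := by
  refine Finset.sum_nbij' Prod.swap Prod.swap ?_ ?_ (fun p _ => p.swap_swap)
    (fun p _ => p.swap_swap) ?_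
  · intro p hp
    rw [mem_hexPoints] at hp ⊢
    dsimp only [Prod.swap]
    omega
  · intro p hp
    rw [mem_hexPoints] at hp ⊢
    dsimp only [Prod.swap]
    omega
  · intro p _
    dsimp only [Prod.swap]
    congr 1
    ring

/-- The sign pattern `x ≤ 0 < y` cuts out one of three rhombi that tile the hexagon. -/
lemma sum_hexPoints_rhombus (n : ℕ) :
    ∑ p ∈ hexPoints n, (if p.1 ≤ 0 ∧ 0 < p.2 then 1 else 0 : ℝ) = (n : ℝ) ^ 2 := by
  rw [Finset.sum_boole]
  -- For these signs the bounds on the third coordinate follow from those on the first two.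
  have : {p ∈ hexPoints n | p.1 ≤ 0 ∧ 0 < p.2} =
      Finset.Icc (-(n : ℤ) + 1) 0 ×ˢ Finset.Icc 1 (n : ℤ) := by
    ext p
    simp only [Finset.mem_filter, mem_hexPoints, Finset.mem_product, Finset.mem_Icc]
    omega
  rw [this, Finset.card_product, Int.card_Icc, Int.card_Icc]
  have h1 : (0 + 1 - (-(n : ℤ) + 1)).toNat = n := by omega
  have h2 : ((n : ℤ) + 1 - 1).toNat = n := by omega
  rw [h1, h2]
  push_cast
  ring

/-- Three integers with sum 1 are neither all positive nor all nonpositive, so in cyclic order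
exactly one nonpositive entry is followed by a positive one: the three rotated rhombi partition the
hexagon. -/
lemma card_hexPoints (n : ℕ) : ((hexPoints n).card : ℝ) = 3 * (n : ℝ) ^ 2 := by
  let F : ℤ → ℤ → ℤ → ℝ := fun x y _ => if x ≤ 0 ∧ 0 < y then 1 else 0
  have h1 : ∑ p ∈ hexPoints n, F p.1 p.2 (1 - p.1 - p.2) = (n : ℝ) ^ 2 := sum_hexPoints_rhombus n
  have h2 := sum_hexPoints_rotate n F
  have h3 := sum_hexPoints_rotate n fun x y z => F y z x
  have : ((hexPoints n).card : ℝ) = ∑ p ∈ hexPoints n, (F p.1 p.2 (1 - p.1 - p.2) +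
      F p.2 (1 - p.1 - p.2) p.1 + F (1 - p.1 - p.2) p.1 p.2) := by
    rw [Finset.cast_card]
    refine Finset.sum_congr rfl fun p _ => ?_
    simp only [F]
    split_ifs <;> first | omega | norm_num
  rw [this, Finset.sum_add_distrib, Finset.sum_add_distrib, h3, h2, h1]
  ring

lemma sum_ind_max (n : ℕ) : ∑ p ∈ hexPoints n, ind n p.1 = n := by
  simp only [ind]
  rw [Finset.sum_boole]
  have : {p ∈ hexPoints n | p.1 = (n : ℤ)} = {(n : ℤ)} ×ˢ Finset.Icc (-(n : ℤ) + 1) 0 := by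
    ext p
    simp only [Finset.mem_filter, mem_hexPoints, Finset.mem_product, Finset.mem_Icc,
      Finset.mem_singleton]
    omega
  rw [this, Finset.card_product, Int.card_Icc, Finset.card_singleton]
  have h1 : (0 + 1 - (-(n : ℤ) + 1)).toNat = n := by omega
  rw [h1, one_mul]

/-- The sides of the hexagon alternate: a side with a maximal coordinate has `n` points, a side with
a minimal one has `n + 1`. -/
lemma sum_ind_min {n : ℕ} (hn : 1 ≤ n) : ∑ p ∈ hexPoints n, ind (1 - n) p.1 = n + 1 := by
  simp only [ind]
  rw [Finset.sum_boole]
  have : {p ∈ hexPoints n | p.1 = 1 - (n : ℤ)} = {1 - (n : ℤ)} ×ˢ Finset.Icc 0 (n : ℤ) := by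
    ext p
    simp only [Finset.mem_filter, mem_hexPoints, Finset.mem_product, Finset.mem_Icc,
      Finset.mem_singleton]
    omega
  rw [this, Finset.card_product, Int.card_Icc, Finset.card_singleton]
  have h1 : ((n : ℤ) + 1 - 0).toNat = n + 1 := by omega
  rw [h1, one_mul]
  push_cast
  ring

lemma sum_ind_max_mul_ind_min {n : ℕ} (hn : 1 ≤ n) :
    ∑ p ∈ hexPoints n, ind n p.1 * ind (1 - n) p.2 = 1 := by
  simp only [ind, mul_ite, mul_one, mul_zero, ← ite_and]
  rw [Finset.sum_boole]
  have : {p ∈ hexPoints n | p.2 = 1 - (n : ℤ) ∧ p.1 = (n : ℤ)} = {((n : ℤ), 1 - (n : ℤ))} := by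
    ext p
    simp only [Finset.mem_filter, mem_hexPoints, Finset.mem_singleton, Prod.ext_iff]
    omega
  rw [this, Finset.card_singleton, Nat.cast_one]

lemma sum_hexPoints_ind_max (n : ℕ) :
    ∑ p ∈ hexPoints n, (ind n p.1 + ind n p.2 + ind n (1 - p.1 - p.2)) = 3 * n := by
  have h := sum_ind_max n
  have h1 := sum_hexPoints_rotate n fun x _ _ => ind n x
  have h2 := sum_hexPoints_rotate n fun _ y _ => ind n y
  rw [Finset.sum_add_distrib, Finset.sum_add_distrib, h2, h1, h]
  ring

lemma sum_hexPoints_ind_min {n : ℕ} (hn : 1 ≤ n) :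
    ∑ p ∈ hexPoints n, (ind (1 - n) p.1 + ind (1 - n) p.2 + ind (1 - n) (1 - p.1 - p.2)) =
      3 * (n + 1) := by
  have h := sum_ind_min hn
  have h1 := sum_hexPoints_rotate n fun x _ _ => ind (1 - n) x
  have h2 := sum_hexPoints_rotate n fun _ y _ => ind (1 - n) y
  rw [Finset.sum_add_distrib, Finset.sum_add_distrib, h2, h1, h]
  ring

lemma ind_max_mul_ind_min (n : ℕ) (x : ℤ) : ind n x * ind (1 - n) x = 0 := by
  rw [mul_eq_zero, ind_eq_zero_iff, ind_eq_zero_iff]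
  omega

/-- Each of the six ordered pairs of distinct coordinates contributes the single point with entries
`n`, `1 - n` and `0`; the diagonal terms vanish because `n = 1 - n` has no integer solution. -/
lemma sum_hexPoints_ind_max_mul_ind_min {n : ℕ} (hn : 1 ≤ n) :
    ∑ p ∈ hexPoints n, (ind n p.1 + ind n p.2 + ind n (1 - p.1 - p.2)) *
      (ind (1 - n) p.1 + ind (1 - n) p.2 + ind (1 - n) (1 - p.1 - p.2)) = 6 := by
  let E : ℤ → ℤ → ℤ → ℝ := fun x y _ => ind n x * ind (1 - n) y
  have h : ∑ p ∈ hexPoints n, E p.1 p.2 (1 - p.1 - p.2) = 1 := sum_ind_max_mul_ind_min hn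
  have h1 := sum_hexPoints_rotate n E
  have h2 := sum_hexPoints_rotate n fun x y z => E y z x
  have h3 := sum_hexPoints_swap n E
  have h4 := sum_hexPoints_rotate n fun x y z => E y x z
  have h5 := sum_hexPoints_rotate n fun x y z => E z y x
  have key (p : ℤ × ℤ) : (ind n p.1 + ind n p.2 + ind n (1 - p.1 - p.2)) *
      (ind (1 - n) p.1 + ind (1 - n) p.2 + ind (1 - n) (1 - p.1 - p.2)) =
      E p.1 p.2 (1 - p.1 - p.2) + E p.2 (1 - p.1 - p.2) p.1 + E (1 - p.1 - p.2) p.1 p.2 +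
      (E p.2 p.1 (1 - p.1 - p.2) + E (1 - p.1 - p.2) p.2 p.1 + E p.1 (1 - p.1 - p.2) p.2) := by
    simp only [E]
    linear_combination ind_max_mul_ind_min n p.1 + ind_max_mul_ind_min n p.2 +
      ind_max_mul_ind_min n (1 - p.1 - p.2)
  simp only [key, Finset.sum_add_distrib]
  rw [h5, h4, h3, h2, h1, h]
  norm_num

lemma ind_cases {m x y z : ℤ} (h : ¬(x = m ∧ y = m)) (h' : ¬(y = m ∧ z = m))
    (h'' : ¬(x = m ∧ z = m)) :
    (ind m x = 0 ∧ ind m y = 0 ∧ ind m z = 0) ∨ (ind m x = 1 ∧ ind m y = 0 ∧ ind m z = 0) ∨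
    (ind m x = 0 ∧ ind m y = 1 ∧ ind m z = 0) ∨ (ind m x = 0 ∧ ind m y = 0 ∧ ind m z = 1) := by
  simp only [ind_eq_one_iff, ind_eq_zero_iff]
  tauto

/-- At most one coordinate attains the largest possible value. -/
lemma ind_max_cases {n : ℕ} {p : ℤ × ℤ} (hp : p ∈ hexPoints n) :
    (ind n p.1 = 0 ∧ ind n p.2 = 0 ∧ ind n (1 - p.1 - p.2) = 0) ∨
    (ind n p.1 = 1 ∧ ind n p.2 = 0 ∧ ind n (1 - p.1 - p.2) = 0) ∨
    (ind n p.1 = 0 ∧ ind n p.2 = 1 ∧ ind n (1 - p.1 - p.2) = 0) ∨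
    (ind n p.1 = 0 ∧ ind n p.2 = 0 ∧ ind n (1 - p.1 - p.2) = 1) := by
  rw [mem_hexPoints] at hp
  apply ind_cases <;> omega

/-- At most one coordinate attains the smallest possible value. -/
lemma ind_min_cases {n : ℕ} (hn : 2 ≤ n) {p : ℤ × ℤ} (hp : p ∈ hexPoints n) :
    (ind (1 - n) p.1 = 0 ∧ ind (1 - n) p.2 = 0 ∧ ind (1 - n) (1 - p.1 - p.2) = 0) ∨
    (ind (1 - n) p.1 = 1 ∧ ind (1 - n) p.2 = 0 ∧ ind (1 - n) (1 - p.1 - p.2) = 0) ∨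
    (ind (1 - n) p.1 = 0 ∧ ind (1 - n) p.2 = 1 ∧ ind (1 - n) (1 - p.1 - p.2) = 0) ∨
    (ind (1 - n) p.1 = 0 ∧ ind (1 - n) p.2 = 0 ∧ ind (1 - n) (1 - p.1 - p.2) = 1) := by
  rw [mem_hexPoints] at hp
  -- Two coordinates equal to `1 - n` make the third `2 * n - 1`, which exceeds `n` once `n ≥ 2`;
  -- for `n = 1` the point `(0, 0, 1)` is an exception.
  apply ind_cases <;> omega

/-! ### The indices of the planar octahedron network -/

/-- The decomposition of a copy of `POH n` into octahedra. -/
noncomputable def pohCells {n : ℕ} {V : Type*} {G : SimpleGraph V} (e : G ≃g POH n) :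
    CellDecomposition G (HoneycombVertex n) :=
  (honeycombColoring n).cellDecomposition.ofIso e

section

variable {n : ℕ} {V : Type*} {G : SimpleGraph V}

lemma pohCells_nbr (e : G ≃g POH n) : (pohCells e).nbr = HoneycombVertex.nbr := rfl

lemma cornerDeg_pohCells (e : G ≃g POH n) (s : HoneycombVertex n) (i : Fin 3) :
    (pohCells e).cornerDeg s i = 8 - 4 * ind n (s.reduced i) := by
  rw [CellDecomposition.cornerDeg, pohCells_nbr]
  cases h : s.nbr i with
  | none =>
    rw [ind_eq_one_iff.2 ((s.nbr_eq_none_iff i).1 h)]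
    norm_num
  | some t =>
    rw [ind_eq_zero_iff.2 fun hn => by simp [(s.nbr_eq_none_iff i).2 hn] at h]
    norm_num

variable [Fintype V]

lemma nbrDegSum_pohCells_true (e : G ≃g POH n) (s : HoneycombVertex n) (i : Fin 3) :
    nbrDegSum G ((pohCells e).corner s (true, i)) =
      24 - 4 * (ind n (s.reduced (i + 1)) + ind n (s.reduced (i + 2))) := by
  classical
  have := Fintype.ofFinite (HoneycombVertex n)
  rw [CellDecomposition.nbrDegSum_true, cornerDeg_pohCells, cornerDeg_pohCells]
  ring

/-- The second summand is the contribution of the adjacent cell, switched off by `1 - ind n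
(s.reduced i)` at a pendant corner. A maximal coordinate of the adjacent cell is a minimal one of
`s`, by `reduced_of_nbr`. -/
lemma nbrDegSum_pohCells_false (e : G ≃g POH n) (s : HoneycombVertex n) (i : Fin 3) :
    nbrDegSum G ((pohCells e).corner s (false, i)) =
      24 - 4 * (ind n (s.reduced (i + 1)) + ind n (s.reduced (i + 2))) +
        (1 - ind n (s.reduced i)) *
          (24 - 4 * (ind (1 - n) (s.reduced (i + 1)) + ind (1 - n) (s.reduced (i + 2)))) := by
  classical
  have := Fintype.ofFinite (HoneycombVertex n)
  rw [CellDecomposition.nbrDegSum_false, pohCells_nbr]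
  cases h : s.nbr i with
  | none =>
    rw [ind_eq_one_iff.2 ((s.nbr_eq_none_iff i).1 h)]
    simp only [cornerDeg_pohCells, Option.elim]
    ring
  | some t =>
    have hind (x : ℤ) : ind n (1 - x) = ind (1 - n) x := by
      simp only [ind]
      congr 1
      exact propext (by omega)
    have h0 : ind n (s.reduced i) = 0 :=
      ind_eq_zero_iff.2 fun hn => by simp [(s.nbr_eq_none_iff i).2 hn] at h
    rw [h0]
    simp only [cornerDeg_pohCells, Option.elim]
    rw [HoneycombVertex.reduced_of_nbr h (j := i + 1) (by fin_cases i <;> decide),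
      HoneycombVertex.reduced_of_nbr h (j := i + 2) (by fin_cases i <;> decide), hind, hind]
    ring

open Classical in
/-- Edge sums over `POH n` of a symmetric function of the degrees of the two ends. -/
lemma sum_edgeFinset_vdeg (e : G ≃g POH n) (g : ℝ → ℝ → ℝ) (hg : ∀ a b, g a b = g b a)
    (h : ∀ u v, g (vdeg G u) (vdeg G v) = g (vdeg G v) (vdeg G u)) :
    ∑ d ∈ G.edgeFinset, Sym2.lift ⟨fun u v => g (vdeg G u) (vdeg G v), h⟩ d =
      6 * (n : ℝ) * ((n - 1) * octahedronSum g 8 8 8 4 4 4 + octahedronSum g 4 8 8 4 4 4) := by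
  have := Fintype.ofFinite (HoneycombVertex n)
  rw [(pohCells e).sum_edgeFinset g hg]
  simp only [CellDecomposition.vdeg_true, CellDecomposition.vdeg_false, cornerDeg_pohCells]
  rw [HoneycombVertex.sum_eq_two_mul fun x y z => octahedronSum g (8 - 4 * ind n x)
    (8 - 4 * ind n y) (8 - 4 * ind n z) 4 4 4]
  -- At most one indicator is 1, so the cell sum is affine in the total of the indicators.
  have key : ∀ p ∈ hexPoints n, octahedronSum g (8 - 4 * ind n p.1) (8 - 4 * ind n p.2)
      (8 - 4 * ind n (1 - p.1 - p.2)) 4 4 4 = octahedronSum g 8 8 8 4 4 4 +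
      (octahedronSum g 4 8 8 4 4 4 - octahedronSum g 8 8 8 4 4 4) *
        (ind n p.1 + ind n p.2 + ind n (1 - p.1 - p.2)) := by
    intro p hp
    have h1 := octahedronSum_rotate g hg 4 8 8 4 4 4
    have h2 := octahedronSum_rotate g hg 8 8 4 4 4 4
    rcases ind_max_cases hp with ⟨hx, hy, hz⟩ | ⟨hx, hy, hz⟩ | ⟨hx, hy, hz⟩ | ⟨hx, hy, hz⟩ <;>
      rw [hx, hy, hz] <;> norm_num [h1, h2]
  rw [Finset.sum_congr rfl key, Finset.sum_add_distrib, ← Finset.mul_sum, sum_hexPoints_ind_max,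
    Finset.sum_const, nsmul_eq_mul, card_hexPoints]
  ring

open Classical in
/-- Edge sums over `POH n` of a symmetric function of the neighbour degree sums of the two ends. -/
lemma sum_edgeFinset_nbrDegSum (e : G ≃g POH n) (hn : 2 ≤ n) (g : ℝ → ℝ → ℝ)
    (hg : ∀ a b, g a b = g b a)
    (h : ∀ u v, g (nbrDegSum G u) (nbrDegSum G v) = g (nbrDegSum G v) (nbrDegSum G u)) :
    ∑ d ∈ G.edgeFinset, Sym2.lift ⟨fun u v => g (nbrDegSum G u) (nbrDegSum G v), h⟩ d =
      6 * ((n : ℝ) - 1) ^ 2 * octahedronSum g 48 48 48 24 24 24 +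
      6 * (n - 1) * octahedronSum g 48 44 44 24 24 24 +
      6 * (n - 2) * octahedronSum g 24 44 44 24 20 20 +
      12 * octahedronSum g 24 44 40 24 20 20 := by
  have := Fintype.ofFinite (HoneycombVertex n)
  rw [(pohCells e).sum_edgeFinset g hg]
  simp only [nbrDegSum_pohCells_true, nbrDegSum_pohCells_false]
  simp only [Fin.reduceAdd, zero_add]
  rw [HoneycombVertex.sum_eq_two_mul fun x y z => octahedronSum g
    (24 - 4 * (ind n y + ind n z) + (1 - ind n x) * (24 - 4 * (ind (1 - n) y + ind (1 - n) z)))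
    (24 - 4 * (ind n z + ind n x) + (1 - ind n y) * (24 - 4 * (ind (1 - n) z + ind (1 - n) x)))
    (24 - 4 * (ind n x + ind n y) + (1 - ind n z) * (24 - 4 * (ind (1 - n) x + ind (1 - n) y)))
    (24 - 4 * (ind n y + ind n z)) (24 - 4 * (ind n z + ind n x)) (24 - 4 * (ind n x + ind n y))]
  have r := octahedronSum_rotate g hg
  have w := octahedronSum_swap g hg
  have hB1 : octahedronSum g 44 48 44 24 24 24 = octahedronSum g 48 44 44 24 24 24 := r ..
  have hB2 : octahedronSum g 44 44 48 24 24 24 = octahedronSum g 48 44 44 24 24 24 :=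
    (r ..).trans hB1
  have hA1 : octahedronSum g 44 24 44 20 24 20 = octahedronSum g 24 44 44 24 20 20 := r ..
  have hA2 : octahedronSum g 44 44 24 20 20 24 = octahedronSum g 24 44 44 24 20 20 :=
    (r ..).trans hA1
  have hE1 : octahedronSum g 24 40 44 24 20 20 = octahedronSum g 24 44 40 24 20 20 := w ..
  have hE2 : octahedronSum g 40 24 44 20 24 20 = octahedronSum g 24 44 40 24 20 20 := r ..
  have hE3 : octahedronSum g 44 24 40 20 24 20 = octahedronSum g 24 44 40 24 20 20 :=
    (r ..).trans hE1
  have hE4 : octahedronSum g 44 40 24 20 20 24 = octahedronSum g 24 44 40 24 20 20 :=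
    (r ..).trans hE2
  have hE5 : octahedronSum g 40 44 24 20 20 24 = octahedronSum g 24 44 40 24 20 20 :=
    (r ..).trans hE3
  -- The totals of the maximal and of the minimal indicators are each 0 or 1, so the cell sum is the
  -- bilinear interpolation of its four values, whose last coefficient is an alternating sum.
  have key : ∀ p ∈ hexPoints n, octahedronSum g
    (24 - 4 * (ind n p.2 + ind n (1 - p.1 - p.2)) +
      (1 - ind n p.1) * (24 - 4 * (ind (1 - n) p.2 + ind (1 - n) (1 - p.1 - p.2))))
    (24 - 4 * (ind n (1 - p.1 - p.2) + ind n p.1) +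
      (1 - ind n p.2) * (24 - 4 * (ind (1 - n) (1 - p.1 - p.2) + ind (1 - n) p.1)))
    (24 - 4 * (ind n p.1 + ind n p.2) +
      (1 - ind n (1 - p.1 - p.2)) * (24 - 4 * (ind (1 - n) p.1 + ind (1 - n) p.2)))
    (24 - 4 * (ind n p.2 + ind n (1 - p.1 - p.2))) (24 - 4 * (ind n (1 - p.1 - p.2) + ind n p.1))
    (24 - 4 * (ind n p.1 + ind n p.2)) =
      octahedronSum g 48 48 48 24 24 24 +
      (octahedronSum g 24 44 44 24 20 20 - octahedronSum g 48 48 48 24 24 24) *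
        (ind n p.1 + ind n p.2 + ind n (1 - p.1 - p.2)) +
      (octahedronSum g 48 44 44 24 24 24 - octahedronSum g 48 48 48 24 24 24) *
        (ind (1 - n) p.1 + ind (1 - n) p.2 + ind (1 - n) (1 - p.1 - p.2)) +
      (octahedronSum g 24 44 40 24 20 20 - octahedronSum g 24 44 44 24 20 20 -
        octahedronSum g 48 44 44 24 24 24 + octahedronSum g 48 48 48 24 24 24) *
        ((ind n p.1 + ind n p.2 + ind n (1 - p.1 - p.2)) *
        (ind (1 - n) p.1 + ind (1 - n) p.2 + ind (1 - n) (1 - p.1 - p.2))) := by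
    intro p hp
    have hx0 := ind_max_mul_ind_min n p.1
    have hy0 := ind_max_mul_ind_min n p.2
    have hz0 := ind_max_mul_ind_min n (1 - p.1 - p.2)
    rcases ind_max_cases hp with ⟨hx, hy, hz⟩ | ⟨hx, hy, hz⟩ | ⟨hx, hy, hz⟩ | ⟨hx, hy, hz⟩ <;>
      rcases ind_min_cases hn hp with ⟨hx', hy', hz'⟩ | ⟨hx', hy', hz'⟩ | ⟨hx', hy', hz'⟩ |
        ⟨hx', hy', hz'⟩ <;>
      rw [hx, hx'] at hx0 <;> rw [hy, hy'] at hy0 <;> rw [hz, hz'] at hz0 <;>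
      -- The discarded cases have the same coordinate both maximal and minimal.
      first
      | (exfalso; linarith)
      | (rw [hx, hy, hz, hx', hy', hz']
         norm_num [hA1, hA2, hB1, hB2, hE1, hE2, hE3, hE4, hE5]
         try ring)
  have hn1 : 1 ≤ n := by omega
  -- Inclusion–exclusion on the counts gives, per class, `3 (n - 1) ^ 2` points with no extremal
  -- coordinate, `3 (n - 1)` with only a minimal one, `3 (n - 2)` with only a maximal one and 6 with
  -- both.
  rw [Finset.sum_congr rfl key, Finset.sum_add_distrib, Finset.sum_add_distrib,
    Finset.sum_add_distrib, ← Finset.mul_sum, ← Finset.mul_sum, ← Finset.mul_sum,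
    sum_hexPoints_ind_max, sum_hexPoints_ind_min hn1, sum_hexPoints_ind_max_mul_ind_min hn1,
    Finset.sum_const, nsmul_eq_mul, card_hexPoints]
  ring

end

/-! ### Values of the weights and the closed formulas. -/

/-- The summand of the atom-bond connectivity indices. -/
noncomputable def abcWeight (x y : ℝ) : ℝ := √((x + y - 2) / (x * y))

/-- The summand of the geometric-arithmetic indices. -/
noncomputable def gaWeight (x y : ℝ) : ℝ := 2 * √(x * y) / (x + y)

lemma abcWeight_comm (x y : ℝ) : abcWeight x y = abcWeight y x := by
  rw [abcWeight, abcWeight, add_comm x, mul_comm x]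

lemma gaWeight_comm (x y : ℝ) : gaWeight x y = gaWeight y x := by
  rw [gaWeight, gaWeight, add_comm x, mul_comm x]

/-- Extracts the square factor `c ^ 2`, so that each weight becomes a rational multiple of a surd in
the final formula and `ring` can treat the surds as atoms. -/
lemma abcWeight_eq {x y c m : ℝ} (hc : 0 ≤ c) (h : (x + y - 2) / (x * y) = c ^ 2 * m) :
    abcWeight x y = c * √m := by
  rw [abcWeight, h, Real.sqrt_mul (sq_nonneg c), Real.sqrt_sq hc]

lemma gaWeight_eq {x y c m : ℝ} (hc : 0 ≤ c) (h : x * y = c ^ 2 * m) :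
    gaWeight x y = 2 * (c * √m) / (x + y) := by
  rw [gaWeight, h, Real.sqrt_mul (sq_nonneg c), Real.sqrt_sq hc]

lemma gaWeight_self {x : ℝ} (hx : 0 < x) : gaWeight x x = 1 := by
  rw [gaWeight, Real.sqrt_mul_self hx.le]
  field_simp
  norm_num

section

variable {n : ℕ} {V : Type*} [Fintype V] {G : SimpleGraph V}

lemma abcIndex_of_iso_POH (e : G ≃g POH n) :
    abcIndex G = 3 / 4 * (n : ℝ) *
        (4 * √6 - 2 * √14 + 3 * (4 * √5 + 2 * √6 + √14) * (n : ℝ)) := by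
  refine (sum_edgeFinset_vdeg e abcWeight abcWeight_comm _).trans ?_
  have h4_4 : abcWeight 4 4 = 1/4 * √6 := abcWeight_eq (by norm_num) (by norm_num)
  have h4_8 : abcWeight 4 8 = 1/4 * √5 := abcWeight_eq (by norm_num) (by norm_num)
  have h8_8 : abcWeight 8 8 = 1/8 * √14 := abcWeight_eq (by norm_num) (by norm_num)
  simp only [octahedronSum, abcWeight_comm 8 4,
    h4_4, h4_8, h8_8]
  ring

lemma gaIndex_of_iso_POH (e : G ≃g POH n) :
    gaIndex G = 12 * (3 + 2 * √2) * (n : ℝ) ^ 2 := by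
  refine (sum_edgeFinset_vdeg e gaWeight gaWeight_comm _).trans ?_
  have h4_4 : gaWeight 4 4 = 1 := gaWeight_self (by norm_num)
  have h4_8 : gaWeight 4 8 = 2/3 * √2 := by
    rw [gaWeight_eq (c := 4) (m := 2) (by norm_num) (by norm_num)]
    ring
  have h8_8 : gaWeight 8 8 = 1 := gaWeight_self (by norm_num)
  simp only [octahedronSum, gaWeight_comm 8 4,
    h4_4, h4_8, h8_8]
  ring

lemma abc4Index_of_iso_POH (e : G ≃g POH n) (hn : 2 ≤ n) :
    abc4Index G = 1 / 440 *
        (264 * √29 + 88 * √930 + 24 * √2255 + 5280 * (-1 + (n : ℝ))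
          + 60 * √330 * (-1 + (n : ℝ)) + 24 * √3410 * (-1 + (n : ℝ))
          + 165 * √94 * (-1 + (n : ℝ)) ^ 2 + 528 * √35 * (n : ℝ) + 132 * √38 * (n : ℝ)
          + 330 * √46 * (-1 + (n : ℝ)) * (n : ℝ) + 60 * √86 * (-3 + 2 * (n : ℝ))
          + 220 * √35 * (2 - 5 * (n : ℝ) + 3 * (n : ℝ) ^ 2)) := by
  refine (sum_edgeFinset_nbrDegSum e hn abcWeight abcWeight_comm _).trans ?_
  have h20_20 : abcWeight 20 20 = 1/20 * √38 := abcWeight_eq (by norm_num) (by norm_num)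
  have h20_24 : abcWeight 20 24 = 1/20 * √35 := abcWeight_eq (by norm_num) (by norm_num)
  have h20_40 : abcWeight 20 40 = 1/20 * √29 := abcWeight_eq (by norm_num) (by norm_num)
  have h20_44 : abcWeight 20 44 = 1/220 * √3410 := abcWeight_eq (by norm_num) (by norm_num)
  have h24_24 : abcWeight 24 24 = 1/24 * √46 := abcWeight_eq (by norm_num) (by norm_num)
  have h24_40 : abcWeight 24 40 = 1/120 * √930 := abcWeight_eq (by norm_num) (by norm_num)
  have h24_44 : abcWeight 24 44 = 1/4 := by
    rw [abcWeight_eq (c := 1/4) (m := 1) (by norm_num) (by norm_num)]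
    norm_num
  have h24_48 : abcWeight 24 48 = 1/24 * √35 := abcWeight_eq (by norm_num) (by norm_num)
  have h40_44 : abcWeight 40 44 = 1/220 * √2255 := abcWeight_eq (by norm_num) (by norm_num)
  have h44_44 : abcWeight 44 44 = 1/44 * √86 := abcWeight_eq (by norm_num) (by norm_num)
  have h44_48 : abcWeight 44 48 = 1/88 * √330 := abcWeight_eq (by norm_num) (by norm_num)
  have h48_48 : abcWeight 48 48 = 1/48 * √94 := abcWeight_eq (by norm_num) (by norm_num)
  simp only [octahedronSum, abcWeight_comm 24 20, abcWeight_comm 40 20, abcWeight_comm 44 20,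
    abcWeight_comm 40 24,
    abcWeight_comm 44 24, abcWeight_comm 48 24, abcWeight_comm 44 40, abcWeight_comm 48 44,
    h20_20, h20_24, h20_40, h20_44, h24_24, h24_40, h24_44, h24_48, h40_44, h44_44, h44_48, h48_48]
  ring

lemma ga5Index_of_iso_POH (e : G ≃g POH n) (hn : 2 ≤ n) :
    ga5Index G = 8 * √2 + 6 * √15 + 8 / 7 * √110 + 48 / 23 * √33 * (-1 + (n : ℝ))
          + 3 / 2 * √55 * (-1 + (n : ℝ)) + 96 / 17 * √66 * (-1 + (n : ℝ)) - 36 * (n : ℝ)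
          + 48 / 11 * √30 * (n : ℝ) + 36 * (n : ℝ) ^ 2
          + 8 * √2 * (2 - 5 * (n : ℝ) + 3 * (n : ℝ) ^ 2) := by
  refine (sum_edgeFinset_nbrDegSum e hn gaWeight gaWeight_comm _).trans ?_
  have h20_20 : gaWeight 20 20 = 1 := gaWeight_self (by norm_num)
  have h20_24 : gaWeight 20 24 = 2/11 * √30 := by
    rw [gaWeight_eq (c := 4) (m := 30) (by norm_num) (by norm_num)]
    ring
  have h20_40 : gaWeight 20 40 = 2/3 * √2 := by
    rw [gaWeight_eq (c := 20) (m := 2) (by norm_num) (by norm_num)]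
    ring
  have h20_44 : gaWeight 20 44 = 1/8 * √55 := by
    rw [gaWeight_eq (c := 4) (m := 55) (by norm_num) (by norm_num)]
    ring
  have h24_24 : gaWeight 24 24 = 1 := gaWeight_self (by norm_num)
  have h24_40 : gaWeight 24 40 = 1/4 * √15 := by
    rw [gaWeight_eq (c := 8) (m := 15) (by norm_num) (by norm_num)]
    ring
  have h24_44 : gaWeight 24 44 = 2/17 * √66 := by
    rw [gaWeight_eq (c := 4) (m := 66) (by norm_num) (by norm_num)]
    ring
  have h24_48 : gaWeight 24 48 = 2/3 * √2 := by
    rw [gaWeight_eq (c := 24) (m := 2) (by norm_num) (by norm_num)]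
    ring
  have h40_44 : gaWeight 40 44 = 2/21 * √110 := by
    rw [gaWeight_eq (c := 4) (m := 110) (by norm_num) (by norm_num)]
    ring
  have h44_44 : gaWeight 44 44 = 1 := gaWeight_self (by norm_num)
  have h44_48 : gaWeight 44 48 = 4/23 * √33 := by
    rw [gaWeight_eq (c := 8) (m := 33) (by norm_num) (by norm_num)]
    ring
  have h48_48 : gaWeight 48 48 = 1 := gaWeight_self (by norm_num)
  simp only [octahedronSum, gaWeight_comm 24 20, gaWeight_comm 40 20, gaWeight_comm 44 20,
    gaWeight_comm 40 24, gaWeight_comm 44 24,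
    gaWeight_comm 48 24, gaWeight_comm 44 40, gaWeight_comm 48 44,
    h20_20, h20_24, h20_40, h20_44, h24_24, h24_40, h24_44, h24_48, h40_44, h44_44, h44_48, h48_48]
  ring

end

theorem theorem3 (n : ℕ) {V : Type*} [Fintype V] (G : SimpleGraph V)
    (hG : Nonempty (G ≃g POH n)) :
    abcIndex G = 3 / 4 * (n : ℝ) *
        (4 * √6 - 2 * √14 + 3 * (4 * √5 + 2 * √6 + √14) * (n : ℝ)) ∧
    gaIndex G = 12 * (3 + 2 * √2) * (n : ℝ) ^ 2 ∧
    (2 ≤ n →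
      abc4Index G = 1 / 440 *
        (264 * √29 + 88 * √930 + 24 * √2255 + 5280 * (-1 + (n : ℝ))
          + 60 * √330 * (-1 + (n : ℝ)) + 24 * √3410 * (-1 + (n : ℝ))
          + 165 * √94 * (-1 + (n : ℝ)) ^ 2 + 528 * √35 * (n : ℝ) + 132 * √38 * (n : ℝ)
          + 330 * √46 * (-1 + (n : ℝ)) * (n : ℝ) + 60 * √86 * (-3 + 2 * (n : ℝ))
          + 220 * √35 * (2 - 5 * (n : ℝ) + 3 * (n : ℝ) ^ 2)) ∧
      ga5Index G = 8 * √2 + 6 * √15 + 8 / 7 * √110 + 48 / 23 * √33 * (-1 + (n : ℝ))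
          + 3 / 2 * √55 * (-1 + (n : ℝ)) + 96 / 17 * √66 * (-1 + (n : ℝ)) - 36 * (n : ℝ)
          + 48 / 11 * √30 * (n : ℝ) + 36 * (n : ℝ) ^ 2
          + 8 * √2 * (2 - 5 * (n : ℝ) + 3 * (n : ℝ) ^ 2)) := by
  obtain ⟨e⟩ := hG
  exact ⟨abcIndex_of_iso_POH e, gaIndex_of_iso_POH e,
    fun hn => ⟨abc4Index_of_iso_POH e hn, ga5Index_of_iso_POH e hn⟩⟩
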